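/- Let $n\ge 3$, let $\Omega\subset\mathbb R^n$ be a bounded domain with $C^\infty$ boundary, and let $\gamma$ be a bounded measurable function from $\overline\Omega$ to the positive-definite symmetric $n\times n$ real matrices. Let $\Psi:\overline\Omega\to\overline\Omega$ be a diffeomorphism ($C^1$ up to the boundary together with its inverse) with $|\det D\Psi|=1$ on $\Omega$ and $\Psi|_{\partial\Omega}=\mathrm{Id}$, and put $$\Psi_*\gamma=\left(\frac{D\Psi\,\gamma\,(D\Psi)^T}{|\det D\Psi|}\right)\circ\Psi^{-1}.$$ For a conductivity $\beta$ on $\overline\Omega$ and $\lambda\in\mathbb R$, a weak solution of $-\mathrm{div}(\beta\nabla u)=\lambda u$ in $\Omega$, $u=f$ on $\partial\Omega$ (with $f\in H^{1/2}(\partial\Omega)$) is a $u\in H^1(\Omega)$ with trace $f$ and $\int_\Omega\beta\nabla u\cdot\nabla v\,dx=\lambda\int_\Omega uv\,dx$ for all $v\in H^1_0(\Omega)$. The Dirichlet-to-Neumann map $\Lambda_{\beta,\lambda}:H^{1/2}(\partial\Omega)\to H^{-1/2}(\partial\Omega)$ is defined by $$\langle\Lambda_{\beta,\lambda}f\,|\,g\rangle=\int_\Omega\beta\nabla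 u\cdot\nabla v\,dx-\lambda\int_\Omega uv\,dx\qquad(g\in H^{1/2}(\partial\Omega)),$$ where $u$ is the weak solution with boundary value $f$ and $v$ is any element of $H^1(\Omega)$ with trace $g$; if $\lambda$ lies in the Dirichlet spectrum of $L_\beta=-\mathrm{div}(\beta\nabla\,\cdot)$, the same formula, with $u$ running over all weak solutions with boundary value $f$, defines a relation (the set of Cauchy data) instead of a map. The Dirichlet spectrum is the set of real $\lambda$ for which $L_\beta-\lambda$, as an operator in $L^2(\Omega)$ with domain $\{u\in H^1_0(\Omega): L_\beta u\in L^2(\Omega)\}$, is not a bijection onto $L^2(\Omega)$. Then $L_{\Psi_*\gamma}$ and $L_\gamma$ have the same Dirichlet spectrum, and for every $\lambda\in\mathbb R$ the graphs of $\Lambda_{\Psi_*\gamma,\lambda}$ and $\Lambda_{\gamma,\lambda}$ (as relations between $H^{1/2}(\partial\Omega)$ and $H^{-1/2}(\partial\Omega)$) coincide; in particular, for every $\lambda$ outside the Dirichlet spectrum of $L_\gamma$, $$\Lambda_{\Psi_*\gamma,\lambda}=\Lambda_{\gamma,\lambda}.$$ -/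

import Mathlib

open MeasureTheory Set
open scoped ContDiff

noncomputable section

namespace DNGauge

/-- Euclidean space `ℝⁿ`. -/
abbrev E (n : ℕ) : Type := EuclideanSpace ℝ (Fin n)

/-! ### Domains, conductivities, diffeomorphisms -/

/-- `Ω` is a bounded domain with `C^∞` boundary: near each boundary point it is the strict sublevel
set `{ρ < 0}` of a smooth function `ρ` with nowhere vanishing differential. -/
structure IsSmoothBoundedDomain {n : ℕ} (Ω : Set (E n)) : Prop where
  isOpen : IsOpen Ω
  isConnected : IsConnected Ω
  isBounded : Bornology.IsBounded Ω
  smooth_boundary : ∀ x ∈ frontier Ω, ∃ (U : Set (E n)) (ρ : E n → ℝ),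
    IsOpen U ∧ x ∈ U ∧ ContDiffOn ℝ ∞ ρ U ∧ (∀ y ∈ U, fderiv ℝ ρ y ≠ 0) ∧
      Ω ∩ U = {y ∈ U | ρ y < 0}

/-- A conductivity on `Ω̄`: a bounded measurable function from `Ω̄` to the positive-definite
symmetric matrices. Values outside `Ω̄` are irrelevant. -/
structure IsConductivity {n : ℕ} (Ω : Set (E n)) (γ : E n → Matrix (Fin n) (Fin n) ℝ) : Prop where
  measurable : ∀ i j, Measurable fun x : closure Ω => γ x i j
  bounded : ∃ C : ℝ, ∀ x ∈ closure Ω, ∀ i j, |γ x i j| ≤ C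
  posDef : ∀ x ∈ closure Ω, (γ x).PosDef

/-- The Jacobian matrix `DΨ(x)` of a map on `Ω̄`, `(DΨ(x))ᵢⱼ = ∂ⱼΨᵢ(x)`. At points of the open set
`Ω` the derivative within `Ω̄` is the ordinary derivative. -/
def jacobian {n : ℕ} (Ω : Set (E n)) (Ψ : E n → E n) (x : E n) : Matrix (Fin n) (Fin n) ℝ :=
  LinearMap.toMatrix (EuclideanSpace.basisFun (Fin n) ℝ).toBasis
    (EuclideanSpace.basisFun (Fin n) ℝ).toBasis
    (fderivWithin ℝ Ψ (closure Ω) x).toLinearMap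

/-- The inverse `Ψ⁻¹ : Ω̄ → Ω̄` of a bijection `Ψ` of `Ω̄`. -/
def inverseOn {n : ℕ} (Ω : Set (E n)) (Ψ : E n → E n) : E n → E n :=
  Function.invFunOn Ψ (closure Ω)

/-- `Ψ ∈ SDiff(Ω̄)`: a diffeomorphism of `Ω̄` onto itself (`C¹` up to the boundary together with
its inverse; this includes diffeomorphisms of any higher regularity) with `|det DΨ| = 1` on `Ω`
and `Ψ = Id` on `∂Ω`. -/
structure IsSDiff {n : ℕ} (Ω : Set (E n)) (Ψ : E n → E n) : Prop where
  bijOn : BijOn Ψ (closure Ω) (closure Ω)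
  contDiffOn : ContDiffOn ℝ 1 Ψ (closure Ω)
  contDiffOn_inverse : ContDiffOn ℝ 1 (inverseOn Ω Ψ) (closure Ω)
  abs_det : ∀ x ∈ Ω, |(jacobian Ω Ψ x).det| = 1
  boundary : ∀ x ∈ frontier Ω, Ψ x = x

/-- `Ψ_*γ = (DΨ γ (DΨ)ᵀ / |det DΨ|) ∘ Ψ⁻¹`. -/
def pushforward {n : ℕ} (Ω : Set (E n)) (Ψ : E n → E n) (γ : E n → Matrix (Fin n) (Fin n) ℝ) :
    E n → Matrix (Fin n) (Fin n) ℝ := fun y =>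
  let x := inverseOn Ω Ψ y
  |(jacobian Ω Ψ x).det|⁻¹ • (jacobian Ω Ψ x * γ x * (jacobian Ω Ψ x).transpose)

/-! ### Sobolev spaces and traces -/

/-- `φ ∈ C_c^∞(Ω)`. -/
structure IsTestFunction {n : ℕ} (Ω : Set (E n)) (φ : E n → ℝ) : Prop where
  smooth : ContDiff ℝ ∞ φ
  compact : HasCompactSupport φ
  support : tsupport φ ⊆ Ω

/-- `L²(Ω; F)`. -/
abbrev L2 {n : ℕ} (Ω : Set (E n)) (F : Type) [NormedAddCommGroup F] : Type :=
  Lp F 2 ((volume : Measure (E n)).restrict Ω)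

/-- `G` is the weak (distributional) gradient of `u` on `Ω`. -/
def IsWeakGradient {n : ℕ} (Ω : Set (E n)) (u : E n → ℝ) (G : E n → E n) : Prop :=
  ∀ φ : E n → ℝ, IsTestFunction Ω φ → ∀ i : Fin n,
    ∫ x in Ω, u x * fderiv ℝ φ x (EuclideanSpace.single i 1) = - ∫ x in Ω, G x i * φ x

theorem IsTestFunction.memLp {n : ℕ} {Ω : Set (E n)} {φ : E n → ℝ} (h : IsTestFunction Ω φ) :
    MemLp φ 2 ((volume : Measure (E n)).restrict Ω) :=
  (h.smooth.continuous.memLp_of_hasCompactSupport h.compact).restrict _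

theorem IsTestFunction.memLp_fderiv {n : ℕ} {Ω : Set (E n)} {φ : E n → ℝ}
    (h : IsTestFunction Ω φ) (w : E n) :
    MemLp (fun x => fderiv ℝ φ x w) 2 ((volume : Measure (E n)).restrict Ω) := by
  refine (Continuous.memLp_of_hasCompactSupport ?_ (h.compact.fderiv_apply (𝕜 := ℝ) w)).restrict _
  exact (h.smooth.continuous_fderiv (by simp)).clm_apply continuous_const

theorem memLp_coord {n : ℕ} {Ω : Set (E n)} (G : L2 Ω (E n)) (i : Fin n) :
    MemLp (fun x => G x i) 2 ((volume : Measure (E n)).restrict Ω) :=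
  (EuclideanSpace.proj i : E n →L[ℝ] ℝ).comp_memLp' (Lp.memLp G)

/-- `H¹(Ω)`, realised as the set of pairs `(u, ∇u) ∈ L²(Ω) × L²(Ω; ℝⁿ)` with `∇u` the weak gradient
of `u`. The norm inherited from the product is equivalent to the usual `H¹` norm. -/
def H1 {n : ℕ} (Ω : Set (E n)) : Submodule ℝ (L2 Ω ℝ × L2 Ω (E n)) where
  carrier := {p | IsWeakGradient Ω p.1 p.2}
  zero_mem' := by
    intro φ _ i
    have h1 : ∫ x in Ω, (0 : L2 Ω ℝ) x * fderiv ℝ φ x (EuclideanSpace.single i 1) = 0 := by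
      rw [← integral_zero (E n) ℝ (μ := volume.restrict Ω)]
      refine integral_congr_ae ?_
      filter_upwards [Lp.coeFn_zero ℝ 2 ((volume : Measure (E n)).restrict Ω)] with x hx
      rw [hx]; simp
    have h2 : ∫ x in Ω, (0 : L2 Ω (E n)) x i * φ x = 0 := by
      rw [← integral_zero (E n) ℝ (μ := volume.restrict Ω)]
      refine integral_congr_ae ?_
      filter_upwards [Lp.coeFn_zero (E n) 2 ((volume : Measure (E n)).restrict Ω)] with x hx
      rw [hx]; simp
    simp only [Prod.fst_zero, Prod.snd_zero]
    rw [h1, h2, neg_zero]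
  add_mem' := by
    rintro ⟨u, G⟩ ⟨v, H⟩ hu hv φ hφ i
    have h1 : ∫ x in Ω, (u + v : L2 Ω ℝ) x * fderiv ℝ φ x (EuclideanSpace.single i 1) =
        ∫ x in Ω, (u x * fderiv ℝ φ x (EuclideanSpace.single i 1) +
          v x * fderiv ℝ φ x (EuclideanSpace.single i 1)) := by
      refine integral_congr_ae ?_
      filter_upwards [Lp.coeFn_add u v] with x hx
      rw [hx]; simp [add_mul]
    have h2 : ∫ x in Ω, (G + H : L2 Ω (E n)) x i * φ x =
        ∫ x in Ω, (G x i * φ x + H x i * φ x) := by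
      refine integral_congr_ae ?_
      filter_upwards [Lp.coeFn_add G H] with x hx
      rw [hx]; simp [add_mul]
    have hu' := hu φ hφ i
    have hv' := hv φ hφ i
    simp only [Prod.mk_add_mk] at *
    have i1 : ∀ w : L2 Ω ℝ, Integrable
        (fun x => w x * fderiv ℝ φ x (EuclideanSpace.single i 1)) (volume.restrict Ω) :=
      fun w => (Lp.memLp w).integrable_mul (hφ.memLp_fderiv _)
    have i2 : ∀ K : L2 Ω (E n), Integrable (fun x => K x i * φ x) (volume.restrict Ω) :=
      fun K => (memLp_coord K i).integrable_mul hφ.memLp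
    rw [h1, h2, integral_add (i1 u) (i1 v), integral_add (i2 G) (i2 H), hu', hv', neg_add]
  smul_mem' := by
    rintro c ⟨u, G⟩ hu φ hφ i
    have h1 : ∫ x in Ω, (c • u : L2 Ω ℝ) x * fderiv ℝ φ x (EuclideanSpace.single i 1) =
        ∫ x in Ω, c * (u x * fderiv ℝ φ x (EuclideanSpace.single i 1)) := by
      refine integral_congr_ae ?_
      filter_upwards [Lp.coeFn_smul c u] with x hx
      rw [hx]; simp [mul_assoc]
    have h2 : ∫ x in Ω, (c • G : L2 Ω (E n)) x i * φ x = ∫ x in Ω, c * (G x i * φ x) := by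
      refine integral_congr_ae ?_
      filter_upwards [Lp.coeFn_smul c G] with x hx
      rw [hx]; simp [mul_assoc]
    have hu' := hu φ hφ i
    simp only [Prod.smul_mk] at *
    rw [h1, h2, integral_const_mul, integral_const_mul, hu', mul_neg]

/-- The underlying function of an element of `H¹(Ω)`. -/
abbrev fn {n : ℕ} {Ω : Set (E n)} (u : H1 Ω) : L2 Ω ℝ := u.1.1

/-- The weak gradient of an element of `H¹(Ω)`. -/
abbrev grad {n : ℕ} {Ω : Set (E n)} (u : H1 Ω) : L2 Ω (E n) := u.1.2

/-- `u ∈ H¹(Ω)` is represented on `Ω` by the classically differentiable function `φ`. -/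
def Represents {n : ℕ} {Ω : Set (E n)} (φ : E n → ℝ) (u : H1 Ω) : Prop :=
  (∀ᵐ x ∂(volume : Measure (E n)).restrict Ω, fn u x = φ x) ∧
    ∀ᵐ x ∂(volume : Measure (E n)).restrict Ω, HasGradientAt φ (grad u x) x

theorem represents_zero {n : ℕ} {Ω : Set (E n)} : Represents (Ω := Ω) (fun _ => 0) (0 : H1 Ω) := by
  constructor
  · filter_upwards [Lp.coeFn_zero ℝ 2 ((volume : Measure (E n)).restrict Ω)] with x hx
    have : fn (0 : H1 Ω) x = 0 := hx
    rw [this]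
  · filter_upwards [Lp.coeFn_zero (E n) 2 ((volume : Measure (E n)).restrict Ω)] with x hx
    have : grad (0 : H1 Ω) x = 0 := hx
    rw [this]
    exact hasGradientAt_const x 0

theorem Represents.add {n : ℕ} {Ω : Set (E n)} {φ ψ : E n → ℝ} {u v : H1 Ω}
    (hu : Represents φ u) (hv : Represents ψ v) :
    Represents (fun x => φ x + ψ x) (u + v) := by
  constructor
  · filter_upwards [hu.1, hv.1, Lp.coeFn_add (fn u) (fn v)] with x h1 h2 h3
    have : fn (u + v) x = fn u x + fn v x := h3
    rw [this, h1, h2]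
  · filter_upwards [hu.2, hv.2, Lp.coeFn_add (grad u) (grad v)] with x h1 h2 h3
    have : grad (u + v) x = grad u x + grad v x := h3
    rw [this, hasGradientAt_iff_hasFDerivAt, map_add]
    exact h1.hasFDerivAt.add h2.hasFDerivAt

theorem Represents.smul {n : ℕ} {Ω : Set (E n)} {φ : E n → ℝ} {u : H1 Ω} (c : ℝ)
    (hu : Represents φ u) : Represents (fun x => c * φ x) (c • u) := by
  constructor
  · filter_upwards [hu.1, Lp.coeFn_smul c (fn u)] with x h1 h3
    have : fn (c • u) x = c * fn u x := h3
    rw [this, h1]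
  · filter_upwards [hu.2, Lp.coeFn_smul c (grad u)] with x h1 h3
    have : grad (c • u) x = c • grad u x := h3
    rw [this, hasGradientAt_iff_hasFDerivAt, map_smul]
    exact h1.hasFDerivAt.const_mul c

/-- `C_c^∞(Ω)` as a subspace of `H¹(Ω)`. -/
def testSpace {n : ℕ} (Ω : Set (E n)) : Submodule ℝ (H1 Ω) where
  carrier := {u | ∃ φ, IsTestFunction Ω φ ∧ Represents φ u}
  zero_mem' := ⟨fun _ => 0, ⟨contDiff_const, HasCompactSupport.zero, by
    rw [show (fun _ : E n => (0 : ℝ)) = 0 from rfl, tsupport_zero]; exact empty_subset _⟩,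
    represents_zero⟩
  add_mem' := by
    rintro u v ⟨φ, hφ, hu⟩ ⟨ψ, hψ, hv⟩
    exact ⟨_, ⟨hφ.smooth.add hψ.smooth, hφ.compact.add hψ.compact,
      (tsupport_add φ ψ).trans (union_subset hφ.support hψ.support)⟩, hu.add hv⟩
  smul_mem' := by
    rintro c u ⟨φ, hφ, hu⟩
    exact ⟨_, ⟨contDiff_const.mul hφ.smooth, hφ.compact.mul_left,
      (tsupport_mul_subset_right (f := fun _ => c)).trans hφ.support⟩, hu.smul c⟩

/-- `H¹₀(Ω)`, the closure of `C_c^∞(Ω)` in `H¹(Ω)`. -/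
def H10 {n : ℕ} (Ω : Set (E n)) : Submodule ℝ (H1 Ω) := (testSpace Ω).topologicalClosure

/-- The surface measure on `∂Ω`: `(n-1)`-dimensional Hausdorff measure restricted to `∂Ω`. -/
def surfaceMeasure {n : ℕ} (Ω : Set (E n)) : Measure (E n) :=
  (Measure.hausdorffMeasure ((n : ℝ) - 1)).restrict (frontier Ω)

/-- `L²(∂Ω)`. -/
abbrev L2Boundary {n : ℕ} (Ω : Set (E n)) : Type := Lp ℝ 2 (surfaceMeasure Ω)

/-- The graph of the restriction map `φ ↦ φ|_∂Ω` on `C¹(Ω̄)`. -/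
def restrictionGraph {n : ℕ} (Ω : Set (E n)) : Submodule ℝ (H1 Ω × L2Boundary Ω) where
  carrier := {p | ∃ φ : E n → ℝ, ContDiffOn ℝ 1 φ (closure Ω) ∧ Represents φ p.1 ∧
    ∀ᵐ x ∂(surfaceMeasure Ω), p.2 x = φ x}
  zero_mem' := ⟨fun _ => 0, contDiffOn_const, represents_zero, by
    filter_upwards [Lp.coeFn_zero ℝ 2 (surfaceMeasure Ω)] with x hx
    exact hx⟩
  add_mem' := by
    rintro ⟨u, f⟩ ⟨v, g⟩ ⟨φ, hφ, hu, hf⟩ ⟨ψ, hψ, hv, hg⟩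
    refine ⟨_, hφ.add hψ, hu.add hv, ?_⟩
    filter_upwards [hf, hg, Lp.coeFn_add f g] with x h1 h2 h3
    simp only [Prod.mk_add_mk] at *
    rw [h3, Pi.add_apply, h1, h2]
  smul_mem' := by
    rintro c ⟨u, f⟩ ⟨φ, hφ, hu, hf⟩
    refine ⟨_, contDiffOn_const.mul hφ, hu.smul c, ?_⟩
    filter_upwards [hf, Lp.coeFn_smul c f] with x h1 h3
    simp only [Prod.smul_mk] at *
    rw [h3, Pi.smul_apply, h1, smul_eq_mul]

/-- The graph of the trace operator `H¹(Ω) → L²(∂Ω)`, the continuous extension of the restriction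
map on `C¹(Ω̄)`: its graph is the closure of the graph of the latter. -/
def traceGraph {n : ℕ} (Ω : Set (E n)) : Submodule ℝ (H1 Ω × L2Boundary Ω) :=
  (restrictionGraph Ω).topologicalClosure

/-- `u|_∂Ω = f` in the sense of traces. -/
def IsTrace {n : ℕ} (Ω : Set (E n)) (u : H1 Ω) (f : L2Boundary Ω) : Prop :=
  (u, f) ∈ traceGraph Ω

/-- `H^{1/2}(∂Ω)`, the space of traces of functions in `H¹(Ω)`. -/
def HHalf {n : ℕ} (Ω : Set (E n)) : Submodule ℝ (L2Boundary Ω) :=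
  (traceGraph Ω).map (LinearMap.snd ℝ (H1 Ω) (L2Boundary Ω))

/-- `H^{-1/2}(∂Ω)`, the space of linear functionals on `H^{1/2}(∂Ω)` that are bounded for the trace
norm `‖g‖ = inf {‖v‖_{H¹} : v|_∂Ω = g}`. -/
def HMinusHalf {n : ℕ} (Ω : Set (E n)) : Submodule ℝ (Module.Dual ℝ (HHalf Ω)) where
  carrier := {l | ∃ C : ℝ, ∀ (v : H1 Ω) (g : HHalf Ω), IsTrace Ω v g → |l g| ≤ C * ‖v‖}
  zero_mem' := ⟨0, fun v g _ => by simp⟩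
  add_mem' := by
    rintro l m ⟨C, hC⟩ ⟨D, hD⟩
    refine ⟨C + D, fun v g h => ?_⟩
    have := abs_add_le (l g) (m g)
    have h1 := hC v g h
    have h2 := hD v g h
    rw [LinearMap.add_apply]
    linarith
  smul_mem' := by
    rintro c l ⟨C, hC⟩
    refine ⟨|c| * C, fun v g h => ?_⟩
    rw [LinearMap.smul_apply, smul_eq_mul, abs_mul, mul_assoc]
    exact mul_le_mul_of_nonneg_left (hC v g h) (abs_nonneg c)

/-! ### The Dirichlet problem and the Dirichlet-to-Neumann map -/

/-- `∫_Ω γ∇u · ∇v dx`. -/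
def energy {n : ℕ} (Ω : Set (E n)) (γ : E n → Matrix (Fin n) (Fin n) ℝ) (u v : H1 Ω) : ℝ :=
  ∫ x in Ω, dotProduct ((γ x).mulVec (grad u x).ofLp) (grad v x).ofLp

/-- `∫_Ω u v dx`. -/
def pairing {n : ℕ} (Ω : Set (E n)) (u v : L2 Ω ℝ) : ℝ := ∫ x in Ω, u x * v x

/-- `u ∈ H¹(Ω)` is a weak solution of `-div(γ∇u) = λu` in `Ω`, `u = f` on `∂Ω`. -/
structure IsWeakSolution {n : ℕ} (Ω : Set (E n)) (γ : E n → Matrix (Fin n) (Fin n) ℝ) (lam : ℝ)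
    (f : HHalf Ω) (u : H1 Ω) : Prop where
  equation : ∀ v ∈ H10 Ω, energy Ω γ u v = lam * pairing Ω (fn u) (fn v)
  trace : IsTrace Ω u f

/-- The (real) Dirichlet spectrum of `L_γ = -div(γ∇·)`, regarded as an operator in `L²(Ω)` with
domain `{u ∈ H¹₀(Ω) : L_γ u ∈ L²(Ω)}`: the set of `λ` for which `L_γ - λ` is not a bijection from
its domain onto `L²(Ω)`. -/
def dirichletSpectrum {n : ℕ} (Ω : Set (E n)) (γ : E n → Matrix (Fin n) (Fin n) ℝ) : Set ℝ :=
  {lam | ¬ ∀ h : L2 Ω ℝ, ∃! u : H1 Ω, u ∈ H10 Ω ∧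
    ∀ v ∈ H10 Ω, energy Ω γ u v - lam * pairing Ω (fn u) (fn v) = pairing Ω h (fn v)}

/-- The graph of the Dirichlet-to-Neumann map `Λ_{γ,λ} : H^{1/2}(∂Ω) → H^{-1/2}(∂Ω)`: the pairs
`(f, Λf)` such that, for a weak solution `u` with boundary value `f`,
`⟨Λf | g⟩ = ∫_Ω γ∇u · ∇v dx - λ ∫_Ω u v dx` for all `g ∈ H^{1/2}(∂Ω)` and all `v ∈ H¹(Ω)` with
`v|_∂Ω = g`. For `λ` in the Dirichlet spectrum this is the set of Cauchy data. -/
def dnGraph {n : ℕ} (Ω : Set (E n)) (γ : E n → Matrix (Fin n) (Fin n) ℝ) (lam : ℝ) :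
    Set (HHalf Ω × HMinusHalf Ω) :=
  {p | ∃ u : H1 Ω, IsWeakSolution Ω γ lam p.1 u ∧
    ∀ (g : HHalf Ω) (v : H1 Ω), IsTrace Ω v g →
      p.2.1 g = energy Ω γ u v - lam * pairing Ω (fn u) (fn v)}

open Classical in
/-- The Dirichlet-to-Neumann map as a function: `Λ_{γ,λ} f` is the unique element of
`H^{-1/2}(∂Ω)` paired with `f` in the graph (with value `0` where there is no such unique
element). -/
def dnMap {n : ℕ} (Ω : Set (E n)) (γ : E n → Matrix (Fin n) (Fin n) ℝ) (lam : ℝ) (f : HHalf Ω) :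
    HMinusHalf Ω :=
  if h : ∃! l : HMinusHalf Ω, (f, l) ∈ dnGraph Ω γ lam then h.choose else 0

end DNGauge

end

noncomputable section

namespace DNGauge

open Filter Topology

variable {n : ℕ} {Ω : Set (E n)}

/-! ### Mollification of compactly supported continuous functions -/

/-! Since `Ψ` fixes `∂Ω`, extending it by the identity gives a homeomorphism of `ℝⁿ`
(`IsSDiff.isGauge`). The theorem says that the pullback `u ↦ u ∘ Ψ` is an automorphism of `H¹(Ω)`
respecting every ingredient of the Dirichlet problem. It preserves `H¹₀` (`pullback_mem_H10`) and
traces (`isTrace_pullback`). It preserves the `L²` pairing because the Jacobian determinant is `±1`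
(`pairing_pullback`). It turns the energy of `Ψ_*γ` into that of `γ` because `∇(u ∘ Ψ) = (DΨ)ᵀ (∇u ∘
Ψ)` (`energy_pullback`). So solutions for `Ψ_*γ` pull back to solutions for `γ` with the same `λ`
and the same Cauchy data. Applying this to `Ψ⁻¹` as well gives equality of spectra and graphs.

The analytic core is the weak chain rule `isWeakGradient_comp`, where `u` is only weakly
differentiable and `Ψ` only `C¹`. The argument is by duality, without approximating `u`. For a test
function `φ`, the field `b_j = (∂ᵢΨ_j · φ) ∘ Ψ⁻¹` is continuous, compactly supported in `Ω`, and has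
weak divergence `(∂ᵢφ) ∘ Ψ⁻¹`. This is a weak Piola identity, needing no second derivatives of `Ψ`.
Mollifying `b` gives admissible test fields, and `integral_mul_eq_of_weak_div` passes to the limit.
-/

/-- A sequence of bump functions at the origin whose supports shrink to a point. -/
def shrinkingBump (n k : ℕ) : ContDiffBump (0 : E n) :=
  ⟨1 / (k + 1) / 2, 1 / (k + 1), by positivity, half_lt_self (by positivity)⟩

theorem eventually_shrinkingBump_rOut_lt {δ : ℝ} (hδ : 0 < δ) :
    ∀ᶠ k in atTop, (shrinkingBump n k).rOut < δ :=
  tendsto_one_div_add_atTop_nhds_zero_nat.eventually (gt_mem_nhds hδ)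

/-- The `k`-th mollification of `g`. -/
def mollify {F : Type*} [NormedAddCommGroup F] [NormedSpace ℝ F] (k : ℕ) (g : E n → F) : E n → F :=
  convolution ((shrinkingBump n k).normed volume) g (ContinuousLinearMap.lsmul ℝ ℝ) volume

theorem eventually_norm_mollify_sub_le {F : Type*} [NormedAddCommGroup F] [NormedSpace ℝ F]
    [CompleteSpace F] {g : E n → F} (hg : Continuous g) (hc : HasCompactSupport g) {ε : ℝ}
    (hε : 0 < ε) : ∀ᶠ k in atTop, ∀ x, ‖mollify k g x - g x‖ ≤ ε := by
  obtain ⟨δ, hδ, h⟩ := Metric.uniformContinuous_iff.1 (hc.uniformContinuous_of_continuous hg) ε hε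
  filter_upwards [eventually_shrinkingBump_rOut_lt hδ] with k hk x
  rw [← dist_eq_norm]
  refine ContDiffBump.dist_normed_convolution_le
    (hg.locallyIntegrable (μ := volume)).aestronglyMeasurable fun y hy => ?_
  exact (h ((Metric.mem_ball.1 hy).trans hk)).le

theorem eventually_isTestFunction_mollify (hΩ : IsOpen Ω) {g : E n → ℝ} (hg : Continuous g)
    (hc : HasCompactSupport g) (hs : tsupport g ⊆ Ω) :
    ∀ᶠ k in atTop, IsTestFunction Ω (mollify k g) := by
  obtain ⟨δ, hδ, h⟩ := hc.isCompact.exists_cthickening_subset_open hΩ hs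
  filter_upwards [eventually_shrinkingBump_rOut_lt hδ] with k hk
  refine ⟨(shrinkingBump n k).hasCompactSupport_normed.contDiff_convolution_left _
    (shrinkingBump n k).contDiff_normed hg.locallyIntegrable,
    (shrinkingBump n k).hasCompactSupport_normed.convolution _ hc, ?_⟩
  refine (closure_minimal ?_ Metric.isClosed_cthickening).trans h
  refine (support_convolution_subset _).trans ?_
  rintro _ ⟨y, hy, z, hz, rfl⟩
  rw [ContDiffBump.support_normed_eq] at hy
  refine Metric.mem_cthickening_of_dist_le _ z _ _ (subset_closure hz) ?_
  have : ‖y‖ < (shrinkingBump n k).rOut := by simpa using hy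
  simpa [dist_eq_norm] using (this.trans hk).le

theorem fderiv_mollify {w : E n → ℝ} (hw : ContDiff ℝ 1 w) (hc : HasCompactSupport w) (k : ℕ)
    (x : E n) : fderiv ℝ (mollify k w) x = mollify k (fderiv ℝ w) x := by
  have h := (hc.hasFDerivAt_convolution_right (ContinuousLinearMap.lsmul ℝ ℝ)
    (((shrinkingBump n k).continuous_normed (μ := volume)).locallyIntegrable (μ := volume))
    hw x).fderiv
  have e : (ContinuousLinearMap.lsmul ℝ ℝ : ℝ →L[ℝ] ℝ →L[ℝ] ℝ).precompR (E n) =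
      ContinuousLinearMap.lsmul ℝ ℝ := by ext; simp
  rw [e] at h
  exact h

theorem tendsto_integral_mul_mollify [IsFiniteMeasure ((volume : Measure (E n)).restrict Ω)]
    {u : E n → ℝ} (hu : MemLp u 2 ((volume : Measure (E n)).restrict Ω)) {g : E n → ℝ}
    (hg : Continuous g) (hc : HasCompactSupport g) :
    Tendsto (fun k => ∫ x in Ω, u x * mollify k g x) atTop (𝓝 (∫ x in Ω, u x * g x)) := by
  have hu1 : Integrable u ((volume : Measure (E n)).restrict Ω) := hu.integrable (by norm_num)
  obtain ⟨C, hC⟩ := hc.exists_bound_of_continuous hg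
  have hm : ∀ k, Continuous (mollify k g) := fun k =>
    ((shrinkingBump n k).hasCompactSupport_normed.contDiff_convolution_left (n := 0) _
      (shrinkingBump n k).contDiff_normed (hg.locallyIntegrable (μ := volume))).continuous
  -- `C` bounds `g`, and the extra `1` absorbs the uniform mollification error for large `k`. The
  -- finite measure makes `u` integrable.
  refine tendsto_integral_filter_of_dominated_convergence (fun x => ‖u x‖ * (C + 1)) ?_ ?_
    (hu1.norm.mul_const _) ?_
  · exact Eventually.of_forall fun k =>
      hu1.aestronglyMeasurable.mul (hm k).aestronglyMeasurable
  · filter_upwards [eventually_norm_mollify_sub_le hg hc one_pos] with k hk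
    refine Eventually.of_forall fun x => ?_
    rw [norm_mul]
    refine mul_le_mul_of_nonneg_left ?_ (norm_nonneg _)
    have := norm_add_le (mollify k g x - g x) (g x)
    rw [sub_add_cancel] at this
    linarith [hk x, hC x]
  · refine Eventually.of_forall fun x => Tendsto.const_mul _ ?_
    refine Metric.tendsto_nhds.2 fun ε hε => ?_
    filter_upwards [eventually_norm_mollify_sub_le hg hc (half_pos hε)] with k hk
    rw [dist_eq_norm]
    linarith [hk x]

/-! ### Weakly divergence-related fields -/

/-- If `div b = a` in the sense of distributions, the same holds after mollification. -/
theorem mollify_eq_sum_fderiv {a : E n → ℝ} {b : Fin n → E n → ℝ} (hb : ∀ j, Continuous (b j))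
    (h : ∀ η : E n → ℝ, ContDiff ℝ ∞ η → HasCompactSupport η →
      ∫ x, η x * a x = -∑ j, ∫ x, fderiv ℝ η x (EuclideanSpace.single j 1) * b j x)
    (k : ℕ) (x : E n) :
    mollify k a x = ∑ j, fderiv ℝ (mollify k (b j)) x (EuclideanSpace.single j 1) := by
  set ρ := (shrinkingBump n k).normed volume
  have hρs : ContDiff ℝ ∞ ρ := (shrinkingBump n k).contDiff_normed
  have hρc : HasCompactSupport ρ := (shrinkingBump n k).hasCompactSupport_normed
  have hη : ∀ t v, fderiv ℝ (fun t => ρ (x - t)) t v = -(fderiv ℝ ρ (x - t) v) := by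
    intro t v
    have h1 : HasFDerivAt (fun t => ρ (x - t)) _ t :=
      ((hρs.differentiable (by simp)) (x - t)).hasFDerivAt.comp t ((hasFDerivAt_id t).const_sub x)
    rw [h1.fderiv]; simp
  -- Testing the weak divergence against the reflected, translated kernel gives the mollified
  -- identity at `x`. The sign from differentiating `x - t` cancels the one in `h`.
  have key := h (fun t => ρ (x - t)) (hρs.comp (contDiff_const.sub contDiff_id))
    (hρc.comp_homeomorph (Homeomorph.subLeft x))
  have e1 : mollify k a x = ∫ t, ρ (x - t) * a t := by
    rw [mollify, convolution_eq_swap]; rfl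
  rw [e1, key, ← Finset.sum_neg_distrib]
  refine Finset.sum_congr rfl fun j _ => ?_
  have hd := (hρc.hasFDerivAt_convolution_left (ContinuousLinearMap.lsmul ℝ ℝ)
    (hρs.of_le (by simp)) ((hb j).locallyIntegrable (μ := volume)) x).fderiv
  have hd' : fderiv ℝ (mollify k (b j)) x = _ := hd
  have hi : ConvolutionExistsAt (fderiv ℝ ρ) (b j) x
      ((ContinuousLinearMap.lsmul ℝ ℝ : ℝ →L[ℝ] ℝ →L[ℝ] ℝ).precompL (E n)) volume :=
    (hρc.fderiv (𝕜 := ℝ)).convolutionExists_left _ (hρs.continuous_fderiv (by simp))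
      (hb j).locallyIntegrable x
  rw [hd', convolution_eq_swap, ContinuousLinearMap.integral_apply hi.integrable_swap,
    ← integral_neg]
  refine integral_congr_ae (Eventually.of_forall fun t => ?_)
  simp [hη]

/-- Distributional integration by parts against a continuous compactly supported vector field whose
weak divergence is continuous. -/
theorem IsWeakGradient.integral_mul_eq_of_weak_div (hΩ : IsOpen Ω)
    [IsFiniteMeasure ((volume : Measure (E n)).restrict Ω)] {u : E n → ℝ} {G : E n → E n}
    (hu : MemLp u 2 ((volume : Measure (E n)).restrict Ω))
    (hG : ∀ j, MemLp (fun x => G x j) 2 ((volume : Measure (E n)).restrict Ω))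
    (hw : IsWeakGradient Ω u G) {a : E n → ℝ} {b : Fin n → E n → ℝ}
    (ha : Continuous a) (hac : HasCompactSupport a)
    (hb : ∀ j, Continuous (b j)) (hbc : ∀ j, HasCompactSupport (b j))
    (hbs : ∀ j, tsupport (b j) ⊆ Ω)
    (h : ∀ η : E n → ℝ, ContDiff ℝ ∞ η → HasCompactSupport η →
      ∫ x, η x * a x = -∑ j, ∫ x, fderiv ℝ η x (EuclideanSpace.single j 1) * b j x) :
    ∫ x in Ω, u x * a x = -∑ j, ∫ x in Ω, G x j * b j x := by
  have h1 := tendsto_integral_mul_mollify hu ha hac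
  have h2 : Tendsto (fun k => -∑ j, ∫ x in Ω, G x j * mollify k (b j) x) atTop
      (𝓝 (-∑ j, ∫ x in Ω, G x j * b j x)) :=
    (tendsto_finsetSum _ fun j _ => tendsto_integral_mul_mollify (hG j) (hb j) (hbc j)).neg
  refine tendsto_nhds_unique h1 (h2.congr' ?_)
  -- Once every mollified component is a test function in `Ω`, the definition of weak gradient
  -- applies to each; only the supports of the `b j` have to be controlled.
  filter_upwards [eventually_all.2 fun j =>
    eventually_isTestFunction_mollify hΩ (hb j) (hbc j) (hbs j)] with k hk
  simp_rw [mollify_eq_sum_fderiv hb h k, Finset.mul_sum]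
  have hi : ∀ j ∈ Finset.univ, Integrable (fun x => u x * fderiv ℝ (mollify k (b j)) x
      (EuclideanSpace.single j 1)) ((volume : Measure (E n)).restrict Ω) :=
    fun j _ => hu.integrable_mul ((hk j).memLp_fderiv _)
  rw [integral_finsetSum _ hi, ← Finset.sum_neg_distrib]
  exact Finset.sum_congr rfl fun j _ => (hw _ (hk j) j).symm

/-! ### Compactly supported `C¹` functions belong to `H¹₀` -/

theorem memLp_gradient_of_isTestFunction {φ : E n → ℝ} (h : IsTestFunction Ω φ) :
    MemLp (gradient φ) 2 ((volume : Measure (E n)).restrict Ω) := by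
  refine (Continuous.memLp_of_hasCompactSupport ?_ ?_).restrict _
  · exact (InnerProductSpace.toDual ℝ (E n)).symm.continuous.comp
      (h.smooth.continuous_fderiv (by simp))
  · exact (h.compact.fderiv (𝕜 := ℝ)).comp_left
      (map_zero (InnerProductSpace.toDual ℝ (E n)).symm)

theorem gradient_apply {φ : E n → ℝ} (x : E n) (i : Fin n) :
    gradient φ x i = fderiv ℝ φ x (EuclideanSpace.single i 1) := by
  have h : inner ℝ (gradient φ x) (EuclideanSpace.single i 1) =
      fderiv ℝ φ x (EuclideanSpace.single i 1) := by
    simp [gradient, InnerProductSpace.toDual_symm_apply]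
  rw [← h, EuclideanSpace.inner_single_right]; simp

/-- Integration by parts of a function differentiable on `Ω` against a test function. -/
theorem IsTestFunction.integral_mul_fderiv (hΩ : IsOpen Ω) {φ : E n → ℝ} (hφ : IsTestFunction Ω φ)
    {w : E n → ℝ} (hw : ContDiffOn ℝ 1 w Ω) (v : E n) :
    ∫ x, w x * fderiv ℝ φ x v = -∫ x, fderiv ℝ w x v * φ x := by
  have hw' : ContinuousOn (fun x => fderiv ℝ w x v) Ω :=
    (hw.continuousOn_fderiv_of_isOpen hΩ le_rfl).clm_apply continuousOn_const
  have hφ' : Continuous (fun x => fderiv ℝ φ x v) :=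
    (hφ.smooth.continuous_fderiv (by simp)).clm_apply continuous_const
  -- `f` may be irregular off `Ω`, but multiplying by `g` kills it there, so the product is globally
  -- continuous.
  have aux : ∀ {f g : E n → ℝ}, ContinuousOn f Ω → Continuous g → HasCompactSupport g →
      tsupport g ⊆ Ω → Integrable fun x => f x * g x := by
    intro f g hf hg hc hs
    exact ((hf.mul hg.continuousOn).continuous_of_tsupport_subset hΩ
      ((tsupport_mul_subset_right (f := f)).trans hs)).integrable_of_hasCompactSupport hc.mul_left
  refine integral_mul_fderiv_eq_neg_fderiv_mul_of_integrable
    (aux hw' hφ.smooth.continuous hφ.compact hφ.support)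
    (aux hw.continuousOn hφ' (hφ.compact.fderiv_apply (𝕜 := ℝ) v)
      ((tsupport_fderiv_apply_subset ℝ v).trans hφ.support))
    (aux hw.continuousOn hφ.smooth.continuous hφ.compact hφ.support) ?_ ?_
  · exact fun x hx => (hw.differentiableOn one_ne_zero).differentiableAt
      (hΩ.mem_nhds (hφ.support hx))
  · exact fun x _ => hφ.smooth.differentiable (by simp) x

theorem setIntegral_eq_integral_of_tsupport {f : E n → ℝ} (h : tsupport f ⊆ Ω) :
    ∫ x in Ω, f x = ∫ x, f x :=
  setIntegral_eq_integral_of_forall_compl_eq_zero fun _ hx =>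
    image_eq_zero_of_notMem_tsupport fun hx' => hx (h hx')

/-- A test function as an element of `H¹(Ω)`. -/
def IsTestFunction.toH1 {φ : E n → ℝ} (hφ : IsTestFunction Ω φ) : H1 Ω :=
  ⟨(hφ.memLp.toLp φ, (memLp_gradient_of_isTestFunction hφ).toLp (gradient φ)), by
    intro ψ hψ i
    have e1 : ∫ x in Ω, hφ.memLp.toLp φ x * fderiv ℝ ψ x (EuclideanSpace.single i 1) =
        ∫ x in Ω, φ x * fderiv ℝ ψ x (EuclideanSpace.single i 1) := by
      refine integral_congr_ae ?_
      filter_upwards [hφ.memLp.coeFn_toLp] with x hx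
      rw [hx]
    have e2 : ∫ x in Ω, (memLp_gradient_of_isTestFunction hφ).toLp (gradient φ) x i * ψ x =
        ∫ x in Ω, fderiv ℝ φ x (EuclideanSpace.single i 1) * ψ x := by
      refine integral_congr_ae ?_
      filter_upwards [(memLp_gradient_of_isTestFunction hφ).coeFn_toLp] with x hx
      rw [hx, gradient_apply]
    dsimp only
    rw [e1, e2, setIntegral_eq_integral_of_tsupport
        ((tsupport_mul_subset_right (f := φ)).trans
          ((tsupport_fderiv_apply_subset ℝ _).trans hψ.support)),
      setIntegral_eq_integral_of_tsupport (tsupport_mul_subset_right.trans hψ.support)]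
    have hψ' : IsTestFunction univ ψ := ⟨hψ.smooth, hψ.compact, subset_univ _⟩
    exact hψ'.integral_mul_fderiv isOpen_univ (hφ.smooth.of_le (by simp)).contDiffOn _⟩

theorem IsTestFunction.represents_toH1 {φ : E n → ℝ} (hφ : IsTestFunction Ω φ) :
    Represents φ hφ.toH1 := by
  refine ⟨hφ.memLp.coeFn_toLp, ?_⟩
  filter_upwards [(memLp_gradient_of_isTestFunction hφ).coeFn_toLp] with x hx
  have : grad hφ.toH1 x = gradient φ x := hx
  rw [this]
  exact (hφ.smooth.differentiable (by simp) x).hasGradientAt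

/-- Mollifications of `w` are test functions converging to it uniformly together with their
gradients. On a set of finite measure this is convergence in `H¹`. The lemma is needed because
composing a test function with a `C¹` map leaves only a `C¹` function. -/
theorem mem_H10_of_represents (hΩ : IsOpen Ω)
    [IsFiniteMeasure ((volume : Measure (E n)).restrict Ω)] {w : E n → ℝ} (hw : ContDiff ℝ 1 w)
    (hc : HasCompactSupport w) (hs : tsupport w ⊆ Ω) {v : H1 Ω} (hv : Represents w v) :
    v ∈ H10 Ω := by
  set μ := (volume : Measure (E n)).restrict Ω
  -- `M = |Ω|^{1/2}` converts sup bounds into `L²` bounds; dividing by `M + 1` in `δ` avoids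
  -- division by zero.
  set M : ℝ := (measureUnivNNReal μ : ℝ) ^ (2 : ENNReal).toReal⁻¹
  have hM : 0 ≤ M := by positivity
  refine Metric.mem_closure_iff.2 fun ε hε => ?_
  set δ := ε / (M + 1) with hδ
  have hδ0 : 0 < δ := by positivity
  have hMδ : M * δ < ε := by
    rw [hδ, mul_div_assoc', div_lt_iff₀ (by positivity)]
    nlinarith
  have hfc := hc.fderiv (𝕜 := ℝ)
  obtain ⟨k, hk1, hk2, hk3⟩ := ((eventually_isTestFunction_mollify hΩ hw.continuous hc hs).and
    ((eventually_norm_mollify_sub_le hw.continuous hc hδ0).and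
      (eventually_norm_mollify_sub_le (hw.continuous_fderiv one_ne_zero) hfc hδ0))).exists
  refine ⟨hk1.toH1, ⟨_, hk1, hk1.represents_toH1⟩, ?_⟩
  have hr := hk1.represents_toH1
  have n1 : ‖fn (hk1.toH1) - fn v‖ ≤ M * δ := by
    refine Lp.norm_le_of_ae_bound hδ0.le ?_
    filter_upwards [hr.1, hv.1, Lp.coeFn_sub (fn hk1.toH1) (fn v)] with x h1 h2 h3
    rw [h3, Pi.sub_apply, h1, h2]
    exact hk2 x
  have n2 : ‖grad (hk1.toH1) - grad v‖ ≤ M * δ := by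
    refine Lp.norm_le_of_ae_bound hδ0.le ?_
    filter_upwards [hr.2, hv.2, Lp.coeFn_sub (grad hk1.toH1) (grad v)] with x h1 h2 h3
    rw [h3, Pi.sub_apply, ← (InnerProductSpace.toDual ℝ (E n)).norm_map, map_sub,
      ← h1.hasFDerivAt.fderiv, ← h2.hasFDerivAt.fderiv, fderiv_mollify hw hc]
    exact hk3 x
  rw [dist_comm, dist_eq_norm]
  -- The norm inherited from the product is the maximum of the two `L²` norms.
  exact (max_le n1 n2).trans_lt hMδ

/-! ### Volume-preserving homeomorphisms fixing the complement of `Ω` -/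

/-- A homeomorphism of `ℝⁿ` that is the identity off `Ω` and restricts to a volume-preserving
`C¹` diffeomorphism of `Ω̄`. -/
structure IsGauge (Ω : Set (E n)) (Ψ : E n ≃ₜ E n) : Prop where
  eq_self : ∀ x ∉ Ω, Ψ x = x
  contDiffOn : ContDiffOn ℝ 1 Ψ (closure Ω)
  contDiffOn_symm : ContDiffOn ℝ 1 Ψ.symm (closure Ω)
  abs_det : ∀ x ∈ Ω, |(fderiv ℝ Ψ x).det| = 1

/-- The operator norm of the derivative of a `C¹` function on a compact set is bounded on the
interior. -/
theorem exists_bound_fderiv_of_contDiffOn_closure (hΩ : IsOpen Ω) (hb : Bornology.IsBounded Ω)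
    {f : E n → E n} (hf : ContDiffOn ℝ 1 f (closure Ω)) :
    ∃ C : ℝ, ∀ x ∈ Ω, ‖fderiv ℝ f x‖ ≤ C := by
  have hloc : ∀ x ∈ closure Ω, ∃ t ∈ 𝓝[closure Ω] x,
      ∃ C : ℝ, ∀ y ∈ t ∩ Ω, ‖fderiv ℝ f y‖ ≤ C := by
    intro x hx
    obtain ⟨u, hu, -, f', hf', hc⟩ :=
      (contDiffWithinAt_succ_iff_hasFDerivWithinAt (n := 0) (by simp)).1
        (by simpa using hf x hx)
    rw [insert_eq_of_mem hx] at hu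
    have hxu : x ∈ u := mem_of_mem_nhdsWithin hx hu
    have hlt : ∀ᶠ y in 𝓝[u] x, ‖f' y‖ < ‖f' x‖ + 1 :=
      (hc.continuousWithinAt.norm).eventually (gt_mem_nhds (lt_add_one _))
    obtain ⟨U, hUo, hxU, hU⟩ := mem_nhdsWithin.1 hu
    obtain ⟨V, hVo, hxV, hV⟩ := mem_nhdsWithin.1 hlt
    refine ⟨closure Ω ∩ (U ∩ V), inter_mem_nhdsWithin _ ((hUo.inter hVo).mem_nhds ⟨hxU, hxV⟩),
      ‖f' x‖ + 1, ?_⟩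
    rintro y ⟨⟨hyc, hyU, hyV⟩, hyΩ⟩
    -- At an interior point `u` is a full neighbourhood, so the continuous one-sided derivative `f'`
    -- is the ordinary one. This explains why the bound is claimed only on `Ω`.
    have hyu : u ∈ 𝓝 y := by
      filter_upwards [(hUo.inter hΩ).mem_nhds ⟨hyU, hyΩ⟩] with z hz
      exact hU ⟨hz.1, subset_closure hz.2⟩
    have hyu' := mem_of_mem_nhds hyu
    rw [((hf' y hyu').hasFDerivAt hyu).fderiv]
    exact (hV ⟨hyV, hyu'⟩ : ‖f' y‖ < ‖f' x‖ + 1).le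
  obtain ⟨C, hC⟩ := hb.isCompact_closure.induction_on
    (p := fun s => ∃ C : ℝ, ∀ y ∈ s ∩ Ω, ‖fderiv ℝ f y‖ ≤ C) ⟨0, by simp⟩
    (fun s t hst ⟨C, hC⟩ => ⟨C, fun y hy => hC y ⟨hst hy.1, hy.2⟩⟩)
    (fun s t ⟨C, hC⟩ ⟨D, hD⟩ => ⟨max C D, fun y hy => hy.1.elim
      (fun h => (hC y ⟨h, hy.2⟩).trans (le_max_left _ _))
      (fun h => (hD y ⟨h, hy.2⟩).trans (le_max_right _ _))⟩) hloc
  exact ⟨C, fun x hx => hC x ⟨subset_closure hx, hx⟩⟩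

namespace IsGauge

variable {Ψ : E n ≃ₜ E n}

/-- If `Ψ x` lay outside `Ω` it would be a fixed point, and injectivity would give `Ψ x = x`. -/
theorem mem_iff (h : IsGauge Ω Ψ) {x : E n} : Ψ x ∈ Ω ↔ x ∈ Ω := by
  by_cases hx : x ∈ Ω
  · refine iff_of_true ?_ hx
    by_contra hc
    exact hc (by rwa [Ψ.injective (h.eq_self _ hc)])
  · rw [h.eq_self x hx]

theorem symm_eq_self (h : IsGauge Ω Ψ) {x : E n} (hx : x ∉ Ω) : Ψ.symm x = x := by
  rw [Homeomorph.symm_apply_eq, h.eq_self x hx]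

theorem symm_mem_iff (h : IsGauge Ω Ψ) {x : E n} : Ψ.symm x ∈ Ω ↔ x ∈ Ω := by
  rw [← h.mem_iff, Homeomorph.apply_symm_apply]

theorem mapsTo_closure (h : IsGauge Ω Ψ) : MapsTo Ψ (closure Ω) (closure Ω) :=
  MapsTo.closure (fun _ hx => h.mem_iff.2 hx) Ψ.continuous

theorem differentiableAt (h : IsGauge Ω Ψ) (hΩ : IsOpen Ω) {x : E n} (hx : x ∈ Ω) :
    DifferentiableAt ℝ Ψ x :=
  ((h.contDiffOn.mono subset_closure).differentiableOn one_ne_zero).differentiableAt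
    (hΩ.mem_nhds hx)

theorem differentiableAt_symm (h : IsGauge Ω Ψ) (hΩ : IsOpen Ω) {x : E n} (hx : x ∈ Ω) :
    DifferentiableAt ℝ Ψ.symm x :=
  ((h.contDiffOn_symm.mono subset_closure).differentiableOn one_ne_zero).differentiableAt
    (hΩ.mem_nhds hx)

theorem fderiv_comp_fderiv_symm (h : IsGauge Ω Ψ) (hΩ : IsOpen Ω) {x : E n} (hx : x ∈ Ω) :
    (fderiv ℝ Ψ (Ψ.symm x)) ∘L (fderiv ℝ Ψ.symm x) = ContinuousLinearMap.id ℝ (E n) := by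
  have h1 := (h.differentiableAt hΩ (h.symm_mem_iff.2 hx)).hasFDerivAt.comp x
    (h.differentiableAt_symm hΩ hx).hasFDerivAt
  rw [show (Ψ ∘ Ψ.symm : E n → E n) = id from funext fun y => Ψ.apply_symm_apply y] at h1
  exact h1.unique (hasFDerivAt_id x)

protected theorem symm (h : IsGauge Ω Ψ) (hΩ : IsOpen Ω) : IsGauge Ω Ψ.symm where
  eq_self _ hx := h.symm_eq_self hx
  contDiffOn := h.contDiffOn_symm
  contDiffOn_symm := h.contDiffOn
  abs_det x hx := by
    have h1 := congrArg ContinuousLinearMap.det (h.fderiv_comp_fderiv_symm hΩ hx)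
    have h2 : (fderiv ℝ Ψ (Ψ.symm x)).det * (fderiv ℝ Ψ.symm x).det = 1 := by
      simpa [ContinuousLinearMap.det, LinearMap.det_comp] using h1
    have h3 := congrArg abs h2
    rwa [abs_mul, h.abs_det _ (h.symm_mem_iff.2 hx), one_mul, abs_one] at h3

/-- This is the change of variables formula with density `|det DΨ| = 1` and `Ψ(Ω) = Ω`. -/
theorem measurePreserving (h : IsGauge Ω Ψ) (hΩ : IsOpen Ω) :
    MeasurePreserving Ψ ((volume : Measure (E n)).restrict Ω)
      ((volume : Measure (E n)).restrict Ω) := by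
  refine ⟨Ψ.continuous.measurable, ?_⟩
  have him : Ψ '' Ω = Ω := by
    ext x
    exact ⟨fun ⟨y, hy, e⟩ => e ▸ h.mem_iff.2 hy,
      fun hx => ⟨Ψ.symm x, h.symm_mem_iff.2 hx, Ψ.apply_symm_apply x⟩⟩
  have key := map_withDensity_abs_det_fderiv_eq_addHaar (volume : Measure (E n))
    hΩ.measurableSet.nullMeasurableSet
    (fun x hx => (h.differentiableAt hΩ hx).hasFDerivAt.hasFDerivWithinAt) Ψ.injective.injOn
  have hone : (fun x => ENNReal.ofReal |(fderiv ℝ Ψ x).det|)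
      =ᵐ[(volume : Measure (E n)).restrict Ω] 1 := by
    filter_upwards [ae_restrict_mem hΩ.measurableSet] with x hx
    simp [h.abs_det x hx]
  rwa [him, withDensity_congr_ae hone, withDensity_one] at key

theorem setIntegral_comp (h : IsGauge Ω Ψ) (hΩ : IsOpen Ω) (f : E n → ℝ) :
    ∫ x in Ω, f (Ψ x) = ∫ x in Ω, f x :=
  (h.measurePreserving hΩ).integral_comp Ψ.measurableEmbedding f

theorem ae_comp (h : IsGauge Ω Ψ) (hΩ : IsOpen Ω) {p : E n → Prop}
    (hp : ∀ᵐ x ∂(volume : Measure (E n)).restrict Ω, p x) :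
    ∀ᵐ x ∂(volume : Measure (E n)).restrict Ω, p (Ψ x) :=
  (h.measurePreserving hΩ).quasiMeasurePreserving.ae hp

/-! ### Weak chain rule -/

theorem _root_.DNGauge.adjoint_apply_coord (A : E n →L[ℝ] E n) (g : E n) (i : Fin n) :
    ContinuousLinearMap.adjoint A g i = ∑ j, g j * A (EuclideanSpace.single i 1) j := by
  have h1 : inner ℝ (EuclideanSpace.single i (1 : ℝ)) (ContinuousLinearMap.adjoint A g) =
      inner ℝ (A (EuclideanSpace.single i 1)) g := ContinuousLinearMap.adjoint_inner_right A _ g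
  rw [EuclideanSpace.inner_single_left] at h1
  simpa [PiLp.inner_apply] using h1

theorem _root_.DNGauge.clm_apply_eq_sum (L : E n →L[ℝ] ℝ) (v : E n) :
    L v = ∑ j, L (EuclideanSpace.single j 1) * v j := by
  conv_lhs => rw [← (EuclideanSpace.basisFun (Fin n) ℝ).sum_repr v]
  simp [mul_comm]

/-- All derivatives are moved onto the test function: after the substitution `y = Ψ x`, the weak
gradient of `u` is tested against the pushed-forward field `B j ∘ Ψ⁻¹`, and substituting back
produces `(DΨ)ᵀ`. -/
theorem isWeakGradient_comp (h : IsGauge Ω Ψ) (hΩ : IsOpen Ω) (hb : Bornology.IsBounded Ω)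
    {u : E n → ℝ} {G : E n → E n}
    (hu : MemLp u 2 ((volume : Measure (E n)).restrict Ω))
    (hG : ∀ j, MemLp (fun x => G x j) 2 ((volume : Measure (E n)).restrict Ω))
    (hw : IsWeakGradient Ω u G) :
    IsWeakGradient Ω (fun x => u (Ψ x))
      (fun x => ContinuousLinearMap.adjoint (fderiv ℝ Ψ x) (G (Ψ x))) := by
  have : IsFiniteMeasure ((volume : Measure (E n)).restrict Ω) :=
    isFiniteMeasure_restrict.2 hb.measure_lt_top.ne
  intro φ hφ i
  set e := EuclideanSpace.single i (1 : ℝ)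
  have hΨ1 : ContDiffOn ℝ 1 Ψ Ω := h.contDiffOn.mono subset_closure
  let B : Fin n → E n → ℝ := fun j y => (fderiv ℝ Ψ y e) j * φ y
  have hBs : ∀ j, tsupport (B j) ⊆ Ω := fun j => tsupport_mul_subset_right.trans hφ.support
  have hBc : ∀ j, HasCompactSupport (B j) := fun j => hφ.compact.mul_left
  have hB : ∀ j, Continuous (B j) := fun j => by
    refine ContinuousOn.continuous_of_tsupport_subset ?_ hΩ (hBs j)
    refine ContinuousOn.mul ?_ hφ.smooth.continuous.continuousOn
    exact (EuclideanSpace.proj j : E n →L[ℝ] ℝ).continuous.comp_continuousOn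
      ((hΨ1.continuousOn_fderiv_of_isOpen hΩ le_rfl).clm_apply continuousOn_const)
  have hφ' : Continuous (fun x => fderiv ℝ φ x e) :=
    (hφ.smooth.continuous_fderiv (by simp)).clm_apply continuous_const
  have hφs : tsupport (fun x => fderiv ℝ φ x e) ⊆ Ω :=
    (tsupport_fderiv_apply_subset ℝ e).trans hφ.support
  have hbs : ∀ j, tsupport (fun x => B j (Ψ.symm x)) ⊆ Ω := fun j => by
    have := tsupport_comp_eq_preimage (B j) Ψ.symm
    intro x hx
    exact h.symm_mem_iff.1 (hBs j (by
      change x ∈ tsupport (B j ∘ Ψ.symm) at hx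
      rw [this] at hx; exact hx))
  have hbc : ∀ j, HasCompactSupport (fun x => B j (Ψ.symm x)) :=
    fun j => (hBc j).comp_homeomorph Ψ.symm
  have hbcont : ∀ j, Continuous (fun x => B j (Ψ.symm x)) :=
    fun j => (hB j).comp Ψ.symm.continuous
  have key := hw.integral_mul_eq_of_weak_div hΩ hu hG
    (a := fun x => fderiv ℝ φ (Ψ.symm x) e) (b := fun j x => B j (Ψ.symm x))
    (hφ'.comp Ψ.symm.continuous)
    ((hφ.compact.fderiv_apply (𝕜 := ℝ) e).comp_homeomorph Ψ.symm) hbcont hbc hbs ?_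
  · rw [← h.setIntegral_comp hΩ] at key
    simp only [Homeomorph.symm_apply_apply] at key
    rw [key, ← integral_finsetSum, ← h.setIntegral_comp hΩ]
    · congr 1
      refine integral_congr_ae (Eventually.of_forall fun x => ?_)
      simp only [Homeomorph.symm_apply_apply, B]
      rw [adjoint_apply_coord, Finset.sum_mul]
      exact Finset.sum_congr rfl fun j _ => by ring
    · exact fun j _ => (hG j).integrable_mul (q := 2)
        (((hbcont j).memLp_of_hasCompactSupport (hbc j)).restrict Ω)
  -- Weak divergence of the pushed-forward field: pulled back by `Ψ`, the claim is integration by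
  -- parts of `η ∘ Ψ` against `φ`, followed by the classical chain rule.
  · intro η hη hηc
    have has : tsupport (fun x => fderiv ℝ φ (Ψ.symm x) e) ⊆ Ω := by
      intro x hx
      change x ∈ tsupport ((fun x => fderiv ℝ φ x e) ∘ Ψ.symm) at hx
      rw [tsupport_comp_eq_preimage _ Ψ.symm] at hx
      exact h.symm_mem_iff.1 (hφs hx)
    rw [← integral_finsetSum,
      ← setIntegral_eq_integral_of_tsupport (tsupport_mul_subset_right.trans has),
      ← setIntegral_eq_integral_of_forall_compl_eq_zero (s := Ω) (μ := volume)
        (f := fun x => ∑ j, fderiv ℝ η x (EuclideanSpace.single j 1) * B j (Ψ.symm x)),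
      ← h.setIntegral_comp hΩ, ← h.setIntegral_comp hΩ (fun x => ∑ j, _)]
    · simp only [Homeomorph.symm_apply_apply]
      rw [setIntegral_eq_integral_of_tsupport (tsupport_mul_subset_right.trans hφs),
        hφ.integral_mul_fderiv hΩ (w := fun x => η (Ψ x))
          ((hη.of_le (by simp)).comp_contDiffOn hΨ1) e,
        ← setIntegral_eq_integral_of_tsupport (tsupport_mul_subset_right.trans hφ.support)]
      congr 1
      refine integral_congr_ae ?_
      filter_upwards [ae_restrict_mem hΩ.measurableSet] with x hx
      have hd : HasFDerivAt (fun x => η (Ψ x)) _ x :=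
        ((hη.differentiable (by simp)) (Ψ x)).hasFDerivAt.comp x
          (h.differentiableAt hΩ hx).hasFDerivAt
      rw [hd.fderiv, ContinuousLinearMap.comp_apply, clm_apply_eq_sum, Finset.sum_mul]
      exact Finset.sum_congr rfl fun j _ => by simp only [B]; ring
    · intro x hx
      refine Finset.sum_eq_zero fun j _ => ?_
      rw [image_eq_zero_of_notMem_tsupport (f := fun x => B j (Ψ.symm x))
        fun hx' => hx (hbs j hx'), mul_zero]
    · exact fun j _ => Continuous.integrable_of_hasCompactSupport
        (((hη.continuous_fderiv (by simp)).clm_apply continuous_const).mul (hbcont j))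
        ((hbc j).mul_left)

/-! ### The pullback operator on `H¹(Ω)` -/

/-- Being essentially bounded, `(DΨ)ᵀ` acts as a continuous multiplier on `L²`; continuity of the
pullback is what lets it pass to the closures defining `H¹₀` and the trace. -/
theorem memLp_adjoint_fderiv (h : IsGauge Ω Ψ) (hΩ : IsOpen Ω) (hb : Bornology.IsBounded Ω) :
    MemLp (fun x => ContinuousLinearMap.adjoint (fderiv ℝ Ψ x)) ⊤
      ((volume : Measure (E n)).restrict Ω) := by
  obtain ⟨C, hC⟩ := exists_bound_fderiv_of_contDiffOn_closure hΩ hb h.contDiffOn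
  refine memLp_top_of_bound ?_ C ?_
  · exact ContinuousLinearMap.adjoint.continuous.comp_aestronglyMeasurable
      (measurable_fderiv ℝ Ψ).aestronglyMeasurable
  · filter_upwards [ae_restrict_mem hΩ.measurableSet] with x hx
    rw [LinearIsometryEquiv.norm_map]
    exact hC x hx

/-- Pullback of gradients, `g ↦ (DΨ)ᵀ (g ∘ Ψ)`, on `L²(Ω; ℝⁿ)`. -/
def gradPullback (h : IsGauge Ω Ψ) (hΩ : IsOpen Ω) (hb : Bornology.IsBounded Ω) :
    L2 Ω (E n) →L[ℝ] L2 Ω (E n) :=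
  ((ContinuousLinearMap.id ℝ (E n →L[ℝ] E n)).holderL ((volume : Measure (E n)).restrict Ω) ⊤ 2 2
    ((h.memLp_adjoint_fderiv hΩ hb).toLp _)) ∘L
  (Lp.compMeasurePreservingₗᵢ ℝ Ψ (h.measurePreserving hΩ)).toContinuousLinearMap

theorem coeFn_gradPullback (h : IsGauge Ω Ψ) (hΩ : IsOpen Ω) (hb : Bornology.IsBounded Ω)
    (g : L2 Ω (E n)) : ∀ᵐ x ∂(volume : Measure (E n)).restrict Ω,
      h.gradPullback hΩ hb g x = ContinuousLinearMap.adjoint (fderiv ℝ Ψ x) (g (Ψ x)) := by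
  filter_upwards [(ContinuousLinearMap.id ℝ (E n →L[ℝ] E n)).coeFn_holder (r := 2)
      ((h.memLp_adjoint_fderiv hΩ hb).toLp _)
      (Lp.compMeasurePreserving Ψ (h.measurePreserving hΩ) g),
    (h.memLp_adjoint_fderiv hΩ hb).coeFn_toLp,
    Lp.coeFn_compMeasurePreserving g (h.measurePreserving hΩ)] with x h1 h2 h3
  refine Eq.trans h1 ?_
  rw [h2, h3]
  rfl

/-- Pullback `u ↦ u ∘ Ψ` on `L²(Ω)`. -/
def fnPullback (h : IsGauge Ω Ψ) (hΩ : IsOpen Ω) : L2 Ω ℝ →L[ℝ] L2 Ω ℝ :=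
  (Lp.compMeasurePreservingₗᵢ ℝ Ψ (h.measurePreserving hΩ)).toContinuousLinearMap

theorem coeFn_fnPullback (h : IsGauge Ω Ψ) (hΩ : IsOpen Ω) (u : L2 Ω ℝ) :
    ∀ᵐ x ∂(volume : Measure (E n)).restrict Ω, h.fnPullback hΩ u x = u (Ψ x) :=
  Lp.coeFn_compMeasurePreserving u (h.measurePreserving hΩ)

theorem prodMap_pullback_mem (h : IsGauge Ω Ψ) (hΩ : IsOpen Ω) (hb : Bornology.IsBounded Ω)
    (p : H1 Ω) :
    ((h.fnPullback hΩ).prodMap (h.gradPullback hΩ hb)) p.1 ∈ H1 Ω := by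
  intro φ hφ i
  have key := h.isWeakGradient_comp hΩ hb (Lp.memLp (fn p)) (fun j => memLp_coord (grad p) j)
    p.2 φ hφ i
  refine Eq.trans ?_ (key.trans ?_)
  · refine integral_congr_ae ?_
    filter_upwards [h.coeFn_fnPullback hΩ (fn p)] with x hx
    rw [← hx]; rfl
  · congr 1
    refine integral_congr_ae ?_
    filter_upwards [h.coeFn_gradPullback hΩ hb (grad p)] with x hx
    rw [← hx]; rfl

/-- The pullback `u ↦ u ∘ Ψ` on `H¹(Ω)`. -/
def pullback (h : IsGauge Ω Ψ) (hΩ : IsOpen Ω) (hb : Bornology.IsBounded Ω) :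
    H1 Ω →L[ℝ] H1 Ω :=
  (((h.fnPullback hΩ).prodMap (h.gradPullback hΩ hb)) ∘L (H1 Ω).subtypeL).codRestrict (H1 Ω)
    (h.prodMap_pullback_mem hΩ hb)

theorem fn_pullback (h : IsGauge Ω Ψ) (hΩ : IsOpen Ω) (hb : Bornology.IsBounded Ω) (u : H1 Ω) :
    ∀ᵐ x ∂(volume : Measure (E n)).restrict Ω, fn (h.pullback hΩ hb u) x = fn u (Ψ x) :=
  h.coeFn_fnPullback hΩ (fn u)

theorem grad_pullback (h : IsGauge Ω Ψ) (hΩ : IsOpen Ω) (hb : Bornology.IsBounded Ω) (u : H1 Ω) :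
    ∀ᵐ x ∂(volume : Measure (E n)).restrict Ω, grad (h.pullback hΩ hb u) x =
      ContinuousLinearMap.adjoint (fderiv ℝ Ψ x) (grad u (Ψ x)) :=
  h.coeFn_gradPullback hΩ hb (grad u)

theorem fnPullback_symm_fnPullback (h : IsGauge Ω Ψ) (hΩ : IsOpen Ω) (u : L2 Ω ℝ) :
    (h.symm hΩ).fnPullback hΩ (h.fnPullback hΩ u) = u := by
  refine Lp.ext ?_
  filter_upwards [(h.symm hΩ).coeFn_fnPullback hΩ (h.fnPullback hΩ u),
    (h.symm hΩ).ae_comp hΩ (h.coeFn_fnPullback hΩ u)] with x h1 h2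
  rw [h1, h2, Homeomorph.apply_symm_apply]

theorem pullback_symm_pullback (h : IsGauge Ω Ψ) (hΩ : IsOpen Ω) (hb : Bornology.IsBounded Ω)
    (u : H1 Ω) : (h.symm hΩ).pullback hΩ hb (h.pullback hΩ hb u) = u := by
  refine Subtype.ext (Prod.ext (h.fnPullback_symm_fnPullback hΩ (fn u)) (Lp.ext ?_))
  filter_upwards [(h.symm hΩ).grad_pullback hΩ hb (h.pullback hΩ hb u),
    (h.symm hΩ).ae_comp hΩ (h.grad_pullback hΩ hb u),
    ae_restrict_mem hΩ.measurableSet] with x h1 h2 hx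
  refine h1.trans ?_
  rw [h2, ← ContinuousLinearMap.comp_apply, ← ContinuousLinearMap.adjoint_comp,
    h.fderiv_comp_fderiv_symm hΩ hx, Homeomorph.apply_symm_apply, ContinuousLinearMap.adjoint_id]
  rfl

theorem represents_pullback (h : IsGauge Ω Ψ) (hΩ : IsOpen Ω) (hb : Bornology.IsBounded Ω)
    {φ : E n → ℝ} {u : H1 Ω} (hu : Represents φ u) :
    Represents (fun x => φ (Ψ x)) (h.pullback hΩ hb u) := by
  constructor
  · filter_upwards [h.fn_pullback hΩ hb u, h.ae_comp hΩ hu.1] with x h1 h2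
    rw [h1, h2]
  · filter_upwards [h.grad_pullback hΩ hb u, h.ae_comp hΩ hu.2,
      ae_restrict_mem hΩ.measurableSet] with x h1 h2 hx
    rw [hasGradientAt_iff_hasFDerivAt]
    have hd := h2.hasFDerivAt.comp x (h.differentiableAt hΩ hx).hasFDerivAt
    have e : InnerProductSpace.toDual ℝ (E n) (grad (h.pullback hΩ hb u) x) =
        (InnerProductSpace.toDual ℝ (E n) (grad u (Ψ x))) ∘L fderiv ℝ Ψ x := by
      refine ContinuousLinearMap.ext fun v => ?_
      rw [h1, InnerProductSpace.toDual_apply_apply, ContinuousLinearMap.adjoint_inner_left]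
      rfl
    rw [e]
    exact hd

theorem pullback_mem_H10 (h : IsGauge Ω Ψ) (hΩ : IsOpen Ω) (hb : Bornology.IsBounded Ω)
    {u : H1 Ω} (hu : u ∈ H10 Ω) : h.pullback hΩ hb u ∈ H10 Ω := by
  have : IsFiniteMeasure ((volume : Measure (E n)).restrict Ω) :=
    isFiniteMeasure_restrict.2 hb.measure_lt_top.ne
  have hcl : IsClosed (H10 Ω : Set (H1 Ω)) := Submodule.isClosed_topologicalClosure _
  refine closure_minimal (t := (h.pullback hΩ hb) ⁻¹' (H10 Ω)) ?_
    (hcl.preimage (h.pullback hΩ hb).continuous) hu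
  rintro v ⟨φ, hφ, hv⟩
  have hs : tsupport (φ ∘ Ψ) ⊆ Ω := by
    rw [tsupport_comp_eq_preimage]
    exact fun x hx => h.mem_iff.1 (hφ.support hx)
  refine mem_H10_of_represents hΩ (w := φ ∘ Ψ) ?_ (hφ.compact.comp_homeomorph Ψ) hs
    (h.represents_pullback hΩ hb hv)
  rw [contDiff_iff_contDiffAt]
  intro x
  -- `Ψ` need not be differentiable across `∂Ω`, but `φ ∘ Ψ` vanishes near every point off its
  -- support.
  by_cases hx : x ∈ tsupport (φ ∘ Ψ)
  · exact (hφ.smooth.of_le (by simp)).contDiffAt.comp x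
      ((h.contDiffOn.mono subset_closure).contDiffAt (hΩ.mem_nhds (hs hx)))
  · exact contDiffAt_const.congr_of_eventuallyEq (notMem_tsupport_iff_eventuallyEq.1 hx)

/-- Composition with `Ψ` preserves `C¹(Ω̄)` and leaves boundary values unchanged, so it preserves
the restriction graph; continuity extends this to the closure. -/
theorem isTrace_pullback (h : IsGauge Ω Ψ) (hΩ : IsOpen Ω) (hb : Bornology.IsBounded Ω)
    {u : H1 Ω} {f : L2Boundary Ω} (hu : IsTrace Ω u f) : IsTrace Ω (h.pullback hΩ hb u) f := by
  have hcl : IsClosed (traceGraph Ω : Set (H1 Ω × L2Boundary Ω)) :=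
    Submodule.isClosed_topologicalClosure _
  refine closure_minimal (t := (Prod.map (h.pullback hΩ hb) id) ⁻¹' (traceGraph Ω)) ?_
    (hcl.preimage ((h.pullback hΩ hb).continuous.prodMap continuous_id)) hu
  rintro ⟨v, g⟩ ⟨φ, hφ, hv, hg⟩
  refine subset_closure ⟨_, hφ.comp h.contDiffOn h.mapsTo_closure,
    h.represents_pullback hΩ hb hv, ?_⟩
  have hfr : ∀ᵐ x ∂surfaceMeasure Ω, x ∈ frontier Ω :=
    ae_restrict_mem isClosed_frontier.measurableSet
  filter_upwards [hg, hfr] with x h1 h2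
  have hx : x ∉ Ω := by
    rw [hΩ.frontier_eq] at h2
    exact h2.2
  simpa [h.eq_self x hx] using h1

theorem pairing_pullback (h : IsGauge Ω Ψ) (hΩ : IsOpen Ω) (u v : L2 Ω ℝ) :
    pairing Ω (h.fnPullback hΩ u) (h.fnPullback hΩ v) = pairing Ω u v := by
  rw [pairing, pairing, ← h.setIntegral_comp hΩ (fun x => u x * v x)]
  refine integral_congr_ae ?_
  filter_upwards [h.coeFn_fnPullback hΩ u, h.coeFn_fnPullback hΩ v] with x h1 h2
  rw [h1, h2]

/-- The matrix of a linear endomorphism of `ℝⁿ`. -/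
abbrev _root_.DNGauge.stdMatrix (A : E n →L[ℝ] E n) : Matrix (Fin n) (Fin n) ℝ :=
  LinearMap.toMatrix (EuclideanSpace.basisFun (Fin n) ℝ).toBasis
    (EuclideanSpace.basisFun (Fin n) ℝ).toBasis A.toLinearMap

theorem _root_.DNGauge.adjoint_eq_transpose_mulVec (A : E n →L[ℝ] E n) (g : E n) :
    (ContinuousLinearMap.adjoint A g).ofLp = (stdMatrix A).transpose.mulVec g.ofLp := by
  ext i
  rw [adjoint_apply_coord]
  simp [Matrix.mulVec, dotProduct, LinearMap.toMatrix_apply, mul_comm]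

/-- Pointwise, `γ Aᵀp · Aᵀq = (A γ Aᵀ) p · q` with `A = DΨ`; the rest is the volume-preserving
substitution. -/
theorem energy_pullback (h : IsGauge Ω Ψ) (hΩ : IsOpen Ω) (hb : Bornology.IsBounded Ω)
    {β γ : E n → Matrix (Fin n) (Fin n) ℝ}
    (hβ : ∀ x ∈ Ω, β (Ψ x) =
      stdMatrix (fderiv ℝ Ψ x) * γ x * (stdMatrix (fderiv ℝ Ψ x)).transpose) (u v : H1 Ω) :
    energy Ω γ (h.pullback hΩ hb u) (h.pullback hΩ hb v) = energy Ω β u v := by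
  rw [energy, energy, ← h.setIntegral_comp hΩ
    (fun x => dotProduct ((β x).mulVec (grad u x).ofLp) (grad v x).ofLp)]
  refine integral_congr_ae ?_
  filter_upwards [h.grad_pullback hΩ hb u, h.grad_pullback hΩ hb v,
    ae_restrict_mem hΩ.measurableSet] with x h1 h2 hx
  rw [h1, h2, hβ x hx, adjoint_eq_transpose_mulVec, adjoint_eq_transpose_mulVec,
    Matrix.mulVec_transpose (stdMatrix (fderiv ℝ Ψ x)) (grad v (Ψ x)).ofLp,
    dotProduct_comm, ← Matrix.dotProduct_mulVec, dotProduct_comm]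
  simp only [Matrix.mulVec_mulVec, Matrix.mul_assoc]

end IsGauge

/-! ### The gauge homeomorphism of an element of `SDiff(Ω̄)` -/

open Classical in
/-- The extension of a self-map of `Ω̄` by the identity. -/
def extendById (Ω : Set (E n)) (f : E n → E n) : E n → E n := (closure Ω).piecewise f id

theorem extendById_eqOn (f : E n → E n) : EqOn (extendById Ω f) f (closure Ω) := by
  classical exact piecewise_eqOn _ _ _

theorem extendById_eq_self (hΩ : IsOpen Ω) {f : E n → E n} (hf : ∀ x ∈ frontier Ω, f x = x)
    {x : E n} (hx : x ∉ Ω) : extendById Ω f x = x := by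
  classical
  by_cases hc : x ∈ closure Ω
  · rw [extendById_eqOn f hc, hf x (by rw [hΩ.frontier_eq]; exact ⟨hc, hx⟩)]
  · exact piecewise_eq_of_notMem _ _ _ hc

/-- Pasting over the closed sets `Ω̄` and `Ωᶜ`, which overlap in `∂Ω`, where `f` is the identity. -/
theorem continuous_extendById (hΩ : IsOpen Ω) {f : E n → E n} (hf : ∀ x ∈ frontier Ω, f x = x)
    (hc : ContinuousOn f (closure Ω)) : Continuous (extendById Ω f) := by
  have h1 : ContinuousOn (extendById Ω f) (closure Ω) := hc.congr (extendById_eqOn f)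
  have h2 : ContinuousOn (extendById Ω f) Ωᶜ :=
    continuousOn_id.congr fun x hx => extendById_eq_self hΩ hf hx
  rw [← continuousOn_univ]
  refine (h1.union_of_isClosed h2 isClosed_closure hΩ.isClosed_compl).mono fun x _ => ?_
  exact (em (x ∈ Ω)).imp (fun h => subset_closure h) id

theorem extendById_extendById {f g : E n → E n} (hg : MapsTo g (closure Ω) (closure Ω))
    (h : LeftInvOn f g (closure Ω)) (x : E n) : extendById Ω f (extendById Ω g x) = x := by
  classical
  by_cases hx : x ∈ closure Ω
  · rw [extendById_eqOn g hx, extendById_eqOn f (hg hx), h hx]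
  · have e : ∀ k : E n → E n, extendById Ω k x = x := fun k => piecewise_eq_of_notMem _ _ _ hx
    rw [e, e]

namespace IsSDiff

variable {Ψ : E n → E n}

theorem leftInvOn_inverseOn (h : IsSDiff Ω Ψ) : LeftInvOn (inverseOn Ω Ψ) Ψ (closure Ω) :=
  h.bijOn.injOn.leftInvOn_invFunOn

theorem leftInvOn (h : IsSDiff Ω Ψ) : LeftInvOn Ψ (inverseOn Ω Ψ) (closure Ω) :=
  h.bijOn.surjOn.rightInvOn_invFunOn

theorem mapsTo_inverseOn (h : IsSDiff Ω Ψ) : MapsTo (inverseOn Ω Ψ) (closure Ω) (closure Ω) :=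
  h.bijOn.surjOn.mapsTo_invFunOn

theorem inverseOn_boundary (h : IsSDiff Ω Ψ) : ∀ x ∈ frontier Ω, inverseOn Ω Ψ x = x := by
  intro x hx
  have := h.leftInvOn_inverseOn (frontier_subset_closure hx)
  rwa [h.boundary x hx] at this

/-- The extension of `Ψ` by the identity as a homeomorphism of `ℝⁿ`. -/
def toHomeomorph (h : IsSDiff Ω Ψ) (hΩ : IsOpen Ω) : E n ≃ₜ E n where
  toFun := extendById Ω Ψ
  invFun := extendById Ω (inverseOn Ω Ψ)
  left_inv := extendById_extendById h.bijOn.mapsTo h.leftInvOn_inverseOn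
  right_inv := extendById_extendById h.mapsTo_inverseOn h.leftInvOn
  continuous_toFun := continuous_extendById hΩ h.boundary h.contDiffOn.continuousOn
  continuous_invFun := continuous_extendById hΩ h.inverseOn_boundary
    h.contDiffOn_inverse.continuousOn

theorem stdMatrix_fderiv (h : IsSDiff Ω Ψ) (hΩ : IsOpen Ω) {x : E n} (hx : x ∈ Ω) :
    stdMatrix (fderiv ℝ (h.toHomeomorph hΩ) x) = jacobian Ω Ψ x := by
  have h1 : (h.toHomeomorph hΩ : E n → E n) =ᶠ[𝓝 x] Ψ := by
    filter_upwards [hΩ.mem_nhds hx] with y hy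
    exact extendById_eqOn Ψ (subset_closure hy)
  rw [jacobian, h1.fderiv_eq, fderivWithin_of_mem_nhds
    (mem_of_superset (hΩ.mem_nhds hx) subset_closure)]

theorem isGauge (h : IsSDiff Ω Ψ) (hΩ : IsOpen Ω) : IsGauge Ω (h.toHomeomorph hΩ) where
  eq_self _ hx := extendById_eq_self hΩ h.boundary hx
  contDiffOn := h.contDiffOn.congr (extendById_eqOn Ψ)
  contDiffOn_symm := h.contDiffOn_inverse.congr (extendById_eqOn _)
  abs_det x hx := by
    rw [← h.abs_det x hx, ← h.stdMatrix_fderiv hΩ hx, LinearMap.det_toMatrix]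

theorem pushforward_apply (h : IsSDiff Ω Ψ) (hΩ : IsOpen Ω)
    (γ : E n → Matrix (Fin n) (Fin n) ℝ) {x : E n} (hx : x ∈ Ω) :
    pushforward Ω Ψ γ (h.toHomeomorph hΩ x) =
      stdMatrix (fderiv ℝ (h.toHomeomorph hΩ) x) * γ x *
        (stdMatrix (fderiv ℝ (h.toHomeomorph hΩ) x)).transpose := by
  have e : inverseOn Ω Ψ (h.toHomeomorph hΩ x) = x := by
    have : h.toHomeomorph hΩ x = Ψ x := extendById_eqOn Ψ (subset_closure hx)
    rw [this, h.leftInvOn_inverseOn (subset_closure hx)]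
  simp only [pushforward, e, h.abs_det x hx, h.stdMatrix_fderiv hΩ hx, inv_one, one_smul]

end IsSDiff

/-! ### Invariance of the spectrum and of the Cauchy data -/

namespace IsGauge

variable {Ψ : E n ≃ₜ E n} {β γ : E n → Matrix (Fin n) (Fin n) ℝ}

theorem pullback_pullback_symm (h : IsGauge Ω Ψ) (hΩ : IsOpen Ω) (hb : Bornology.IsBounded Ω)
    (u : H1 Ω) : h.pullback hΩ hb ((h.symm hΩ).pullback hΩ hb u) = u :=
  (h.symm hΩ).pullback_symm_pullback hΩ hb u

/-- Makes `hE` symmetric under `Ψ ↔ Ψ⁻¹`, so each inclusion below need be proved in one direction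
only. -/
theorem energy_pullback_symm (h : IsGauge Ω Ψ) (hΩ : IsOpen Ω) (hb : Bornology.IsBounded Ω)
    (hE : ∀ u v, energy Ω γ (h.pullback hΩ hb u) (h.pullback hΩ hb v) = energy Ω β u v)
    (u v : H1 Ω) : energy Ω β ((h.symm hΩ).pullback hΩ hb u) ((h.symm hΩ).pullback hΩ hb v) =
      energy Ω γ u v := by
  rw [← hE, h.pullback_pullback_symm, h.pullback_pullback_symm]

/-- Contrapositive: to solve for `γ` with source `f`, solve for `β` with source `f ∘ Ψ⁻¹` and pull
the solution back. Uniqueness is transported by the inverse pullback. -/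
theorem dirichletSpectrum_subset (h : IsGauge Ω Ψ) (hΩ : IsOpen Ω) (hb : Bornology.IsBounded Ω)
    (hE : ∀ u v, energy Ω γ (h.pullback hΩ hb u) (h.pullback hΩ hb v) = energy Ω β u v) :
    dirichletSpectrum Ω γ ⊆ dirichletSpectrum Ω β := by
  intro lam hlam hβ
  refine hlam fun f => ?_
  set T := h.pullback hΩ hb
  set S := (h.symm hΩ).pullback hΩ hb
  set f' := (h.symm hΩ).fnPullback hΩ f
  have hff : h.fnPullback hΩ f' = f := (h.symm hΩ).fnPullback_symm_fnPullback hΩ f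
  have hpair : ∀ v : H1 Ω, pairing Ω f (fn (T v)) = pairing Ω f' (fn v) := fun v => by
    rw [← h.pairing_pullback hΩ f' (fn v), hff]; rfl
  have hpair' : ∀ u v : H1 Ω, pairing Ω (fn (T u)) (fn (T v)) = pairing Ω (fn u) (fn v) :=
    fun u v => h.pairing_pullback hΩ (fn u) (fn v)
  have hTS : ∀ u, T (S u) = u := h.pullback_pullback_symm hΩ hb
  obtain ⟨u, ⟨hu0, hu⟩, huniq⟩ := hβ f'
  refine ⟨T u, ⟨h.pullback_mem_H10 hΩ hb hu0, fun v hv => ?_⟩, ?_⟩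
  · have hSv := hu (S v) ((h.symm hΩ).pullback_mem_H10 hΩ hb hv)
    rwa [← hE, ← hpair, ← hpair', hTS] at hSv
  · rintro w ⟨hw0, hw⟩
    rw [← huniq (S w) ⟨(h.symm hΩ).pullback_mem_H10 hΩ hb hw0, fun v hv => ?_⟩, hTS]
    have hTv := hw (T v) (h.pullback_mem_H10 hΩ hb hv)
    rwa [← hE, ← hpair, ← hpair', hTS]

theorem dnGraph_subset (h : IsGauge Ω Ψ) (hΩ : IsOpen Ω) (hb : Bornology.IsBounded Ω)
    (hE : ∀ u v, energy Ω γ (h.pullback hΩ hb u) (h.pullback hΩ hb v) = energy Ω β u v)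
    (lam : ℝ) : dnGraph Ω β lam ⊆ dnGraph Ω γ lam := by
  rintro ⟨f, l⟩ ⟨u, ⟨hu, htr⟩, hl⟩
  set T := h.pullback hΩ hb
  set S := (h.symm hΩ).pullback hΩ hb
  have hpair : ∀ u v : H1 Ω, pairing Ω (fn (T u)) (fn (T v)) = pairing Ω (fn u) (fn v) :=
    fun u v => h.pairing_pullback hΩ (fn u) (fn v)
  have hTS : ∀ u, T (S u) = u := h.pullback_pullback_symm hΩ hb
  refine ⟨T u, ⟨fun v hv => ?_, h.isTrace_pullback hΩ hb htr⟩, fun g v hv => ?_⟩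
  -- Every `v` is the pullback of `S v`, so the equation for `u` tested against `S v` is the one for
  -- `T u` tested against `v`.
  · have hSv := hu (S v) ((h.symm hΩ).pullback_mem_H10 hΩ hb hv)
    rwa [← hE, ← hpair, hTS] at hSv
  · have hSv := hl g (S v) ((h.symm hΩ).isTrace_pullback hΩ hb hv)
    rwa [← hE, ← hpair, hTS] at hSv

end IsGauge

end DNGauge

end

theorem proposition1p3 {n : ℕ} (hn : 3 ≤ n) (Ω : Set (DNGauge.E n))
    (hΩ : DNGauge.IsSmoothBoundedDomain Ω)
    (γ : DNGauge.E n → Matrix (Fin n) (Fin n) ℝ) (hγ : DNGauge.IsConductivity Ω γ)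
    (Ψ : DNGauge.E n → DNGauge.E n) (hΨ : DNGauge.IsSDiff Ω Ψ) :
    DNGauge.dirichletSpectrum Ω (DNGauge.pushforward Ω Ψ γ) = DNGauge.dirichletSpectrum Ω γ ∧
    ∀ lam : ℝ,
      DNGauge.dnGraph Ω (DNGauge.pushforward Ω Ψ γ) lam = DNGauge.dnGraph Ω γ lam ∧
      (lam ∉ DNGauge.dirichletSpectrum Ω γ →
        DNGauge.dnMap Ω (DNGauge.pushforward Ω Ψ γ) lam = DNGauge.dnMap Ω γ lam) := by
  have ho := hΩ.isOpen
  have hb := hΩ.isBounded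
  have h := hΨ.isGauge ho
  have hE := h.energy_pullback ho hb (fun x hx => hΨ.pushforward_apply ho γ hx)
  have hE' := h.energy_pullback_symm ho hb hE
  have hgraph : ∀ lam, DNGauge.dnGraph Ω (DNGauge.pushforward Ω Ψ γ) lam =
      DNGauge.dnGraph Ω γ lam := fun lam =>
    (h.dnGraph_subset ho hb hE lam).antisymm ((h.symm ho).dnGraph_subset ho hb hE' lam)
  refine ⟨((h.symm ho).dirichletSpectrum_subset ho hb hE').antisymm
    (h.dirichletSpectrum_subset ho hb hE), fun lam => ⟨hgraph lam, fun _ => ?_⟩⟩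
  -- `dnMap` depends on the conductivity only through its graph.
  funext f
  have hA := hgraph lam
  unfold DNGauge.dnMap
  generalize DNGauge.dnGraph Ω (DNGauge.pushforward Ω Ψ γ) lam = A at hA
  subst hA
  rfl
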